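/- A \emph{biframe} $\mathcal{L}=(\mathcal{L}_0,\mathcal{L}_1,\mathcal{L}_2)$ is a frame $\mathcal{L}_0$ (the total part) with two subframes $\mathcal{L}_1,\mathcal{L}_2$ (the first and second parts) which together generate $\mathcal{L}_0$; a biframe homomorphism $f\colon\mathcal{L}\to\mathcal{M}$ is a frame homomorphism $f_0\colon\mathcal{L}_0\to\mathcal{M}_0$ which maps $\mathcal{L}_i$ into $\mathcal{M}_i$ for $i=1,2$, with restrictions $f_i\colon\mathcal{L}_i\to\mathcal{M}_i$. A biframe $\mathcal{L}$ is \emph{strictly zero-dimensional} if every $a\in\mathcal{L}_1$ has a complement in $\mathcal{L}_0$, this complement lies in $\mathcal{L}_2$, and these complements generate the frame $\mathcal{L}_2$. Let $\mathrm{Str0DBiFrm}$ be the category of strictly zero-dimensional biframes and biframe homomorphisms, and let $\mathrm{P}\colon\mathrm{Str0DBiFrm}\to\mathrm{Frm}$ be the first part functor, $\mathrm{P}\mathcal{L}=\mathcal{L}_1$ and $\mathrm{P}f=f_1$. A biframe homomorphism $f$ is \emph{dense} if $f_0(x)=0$ implies $x=0$. It is a \emph{closed quotient} if $f_1$ and $f_2$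 are surjective and the kernel congruence of $f_0$ is a closed congruence $\nabla_a=\{(x,y)\mid x\vee a=y\vee a\}$ for some $a\in\mathcal{L}_0$. Let $f\colon\mathcal{L}\to\mathcal{M}$ be a morphism in $\mathrm{Str0DBiFrm}$. (1) $f$ is an extremal epimorphism in $\mathrm{Str0DBiFrm}$ if and only if it is a regular epimorphism in $\mathrm{Str0DBiFrm}$, if and only if it is a closed quotient. (2) $f$ is a monomorphism in $\mathrm{Str0DBiFrm}$ if and only if it is dense, if and only if $\mathrm{P}f$ is injective. -/

import Mathlib

open CategoryTheory

universe u

/-- A subframe: closed under finite meets and arbitrary joins. -/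
structure Subframe (α : Type u) [Order.Frame α] where
  carrier : Set α
  top_mem' : ⊤ ∈ carrier
  inf_mem' : ∀ {a b}, a ∈ carrier → b ∈ carrier → a ⊓ b ∈ carrier
  sSup_mem' : ∀ s ⊆ carrier, sSup s ∈ carrier

namespace Subframe

instance {α : Type u} [Order.Frame α] : SetLike (Subframe α) α where
  coe S := S.carrier
  coe_injective S T h := by cases S; congr

/-- The subframe generated by a set: the intersection of all subframes containing it. -/
def generate {α : Type u} [Order.Frame α] (s : Set α) : Subframe α where
  carrier := {x | ∀ S : Subframe α, s ⊆ S → x ∈ S}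
  top_mem' := fun S _ => S.top_mem'
  inf_mem' := fun ha hb S hS => S.inf_mem' (ha S hS) (hb S hS)
  sSup_mem' := fun _ ht S hS => S.sSup_mem' _ (fun _ hx => ht hx S hS)

/-- The frame structure on a subframe: the order, finite meets and joins are inherited. -/
instance instFrame {α : Type u} [Order.Frame α] (S : Subframe α) : Order.Frame S :=
  letI : PartialOrder S := Subtype.partialOrder _
  letI : SupSet S := ⟨fun s => ⟨sSup (Subtype.val '' s), S.sSup_mem' _ (by
    rintro _ ⟨x, _, rfl⟩; exact x.2)⟩⟩
  letI C : CompleteLattice S :=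
    { completeLatticeOfSup S (fun s => ⟨fun x hx =>
          show (x : α) ≤ sSup (Subtype.val '' s) from le_sSup ⟨x, hx, rfl⟩, fun x hx =>
          show sSup (Subtype.val '' s) ≤ (x : α) from
            sSup_le (by rintro _ ⟨y, hy, rfl⟩; exact hx hy)⟩) with
      top := ⟨⊤, S.top_mem'⟩
      le_top := fun x => show (x : α) ≤ ⊤ from le_top
      inf := fun x y => ⟨x ⊓ y, S.inf_mem' x.2 y.2⟩
      inf_le_left := fun x y => show (x : α) ⊓ y ≤ x from inf_le_left
      inf_le_right := fun x y => show (x : α) ⊓ y ≤ y from inf_le_right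
      le_inf := fun x y z h₁ h₂ => show (x : α) ≤ (y : α) ⊓ z from le_inf h₁ h₂ }
  Order.Frame.ofMinimalAxioms
    { C with
      inf_sSup_le_iSup_inf := fun a s => by
        change (a : α) ⊓ sSup (Subtype.val '' s) ≤ ((⨆ b ∈ s, a ⊓ b : S) : α)
        rw [inf_sSup_eq]
        refine iSup₂_le ?_
        rintro _ ⟨b, hb, rfl⟩
        exact show a ⊓ b ≤ (⨆ b ∈ s, a ⊓ b : S) from le_iSup₂ (f := fun b _ => a ⊓ b) b hb }

theorem coe_le_coe {α : Type u} [Order.Frame α] {S : Subframe α} {a b : S} :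
    (a : α) ≤ b ↔ a ≤ b := Iff.rfl

theorem coe_top {α : Type u} [Order.Frame α] (S : Subframe α) : ((⊤ : S) : α) = ⊤ := rfl

theorem coe_inf {α : Type u} [Order.Frame α] {S : Subframe α} (a b : S) :
    ((a ⊓ b : S) : α) = (a : α) ⊓ b := rfl

theorem coe_sSup {α : Type u} [Order.Frame α] {S : Subframe α} (s : Set S) :
    ((sSup s : S) : α) = sSup (Subtype.val '' s) := rfl

/-- The restriction of a frame homomorphism `f` to subframes `S`, `T` with `f(S) ⊆ T`. -/
def restrict {α β : Type u} [Order.Frame α] [Order.Frame β] (f : FrameHom α β)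
    (S : Subframe α) (T : Subframe β) (h : ∀ a ∈ S, f a ∈ T) : FrameHom S T where
  toFun a := ⟨f a, h a a.2⟩
  map_inf' a b := Subtype.ext (map_inf f (a : α) b)
  map_top' := Subtype.ext (map_top f)
  map_sSup' s := Subtype.ext (by
    change f (sSup (Subtype.val '' s)) = sSup (Subtype.val '' _)
    rw [map_sSup, Set.image_image, Set.image_image])

end Subframe

/-- A congruence on a frame: an equivalence relation that is a subframe of `L × L`. -/
structure FrameCongruence (L : Type u) [Order.Frame L] extends Subframe (L × L) where
  refl' : ∀ x, (x, x) ∈ carrier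
  symm' : ∀ {x y}, (x, y) ∈ carrier → (y, x) ∈ carrier
  trans' : ∀ {x y z}, (x, y) ∈ carrier → (y, z) ∈ carrier → (x, z) ∈ carrier

namespace FrameCongruence

/-- The closed congruence `∇ₐ = {(x, y) | x ∨ a = y ∨ a}`. -/
def closed {L : Type u} [Order.Frame L] (a : L) : FrameCongruence L where
  carrier := {p | p.1 ⊔ a = p.2 ⊔ a}
  top_mem' := rfl
  inf_mem' := by
    intro p q hp hq
    change p.1 ⊓ q.1 ⊔ a = p.2 ⊓ q.2 ⊔ a
    rw [sup_inf_right, sup_inf_right, show p.1 ⊔ a = p.2 ⊔ a from hp,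
      show q.1 ⊔ a = q.2 ⊔ a from hq]
  sSup_mem' := by
    intro s hs
    change sSup (Prod.fst '' s) ⊔ a = sSup (Prod.snd '' s) ⊔ a
    apply le_antisymm
    · refine sup_le (sSup_le ?_) le_sup_right
      rintro _ ⟨p, hp, rfl⟩
      exact (le_sup_left.trans (hs hp).le).trans
        (sup_le_sup_right (le_sSup (Set.mem_image_of_mem _ hp)) a)
    · refine sup_le (sSup_le ?_) le_sup_right
      rintro _ ⟨p, hp, rfl⟩
      exact (le_sup_left.trans (hs hp).ge).trans
        (sup_le_sup_right (le_sSup (Set.mem_image_of_mem _ hp)) a)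
  refl' _ := rfl
  symm' h := Eq.symm h
  trans' h₁ h₂ := Eq.trans h₁ h₂

/-- `∇ₐ` is the congruence generated by the pair `(0, a)`. -/
theorem closed_isLeast {L : Type u} [Order.Frame L] (a : L) :
    (⊥, a) ∈ (closed a).carrier ∧
      ∀ C : FrameCongruence L, (⊥, a) ∈ C.carrier → (closed a).carrier ⊆ C.carrier := by
  refine ⟨show ⊥ ⊔ a = a ⊔ a by simp, fun C hC p hp => ?_⟩
  have key : ∀ x : L, (x, x ⊔ a) ∈ C.carrier := fun x => by
    have h := C.sSup_mem' {(x, x), (⊥, a)} (by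
      rintro q (rfl | rfl)
      · exact C.refl' x
      · exact hC)
    rw [sSup_pair] at h
    simpa using h
  have hp' : p.1 ⊔ a = p.2 ⊔ a := hp
  have h := C.trans' (key p.1) (hp' ▸ C.symm' (key p.2))
  exact h

/-- The kernel congruence of a frame homomorphism. -/
def ker {L M : Type u} [Order.Frame L] [Order.Frame M] (f : FrameHom L M) :
    FrameCongruence L where
  carrier := {p | f p.1 = f p.2}
  top_mem' := rfl
  inf_mem' := by
    intro p q hp hq
    change f (p.1 ⊓ q.1) = f (p.2 ⊓ q.2)
    rw [map_inf, map_inf, show f p.1 = f p.2 from hp, show f q.1 = f q.2 from hq]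
  sSup_mem' := by
    intro s hs
    change f (sSup (Prod.fst '' s)) = f (sSup (Prod.snd '' s))
    rw [map_sSup, map_sSup, Set.image_image, Set.image_image]
    exact congrArg sSup (Set.image_congr fun p hp => hs hp)
  refl' _ := rfl
  symm' h := Eq.symm h
  trans' h₁ h₂ := Eq.trans h₁ h₂

end FrameCongruence

/-- A biframe: a frame (the total part) with two subframes which together generate it. -/
structure BiFrm where
  total : Type u
  [frame : Order.Frame total]
  first : Subframe total
  second : Subframe total
  generates : ∀ x, x ∈ Subframe.generate ((first : Set total) ∪ second)

namespace BiFrm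

attribute [instance] BiFrm.frame

/-- A biframe homomorphism: a frame homomorphism between total parts preserving both parts. -/
@[ext]
structure Hom (L M : BiFrm.{u}) where
  total : FrameHom L.total M.total
  map_first : ∀ a ∈ L.first, total a ∈ M.first
  map_second : ∀ a ∈ L.second, total a ∈ M.second

instance : Category BiFrm.{u} where
  Hom := Hom
  id L := ⟨FrameHom.id L.total, fun _ h => h, fun _ h => h⟩
  comp f g := ⟨g.total.comp f.total, fun a h => g.map_first _ (f.map_first a h),
    fun a h => g.map_second _ (f.map_second a h)⟩

/-- The restriction of a biframe homomorphism to the first parts. -/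
def Hom.firstMap {L M : BiFrm.{u}} (f : Hom L M) : FrameHom L.first M.first :=
  Subframe.restrict f.total L.first M.first f.map_first

/-- The restriction of a biframe homomorphism to the second parts. -/
def Hom.secondMap {L M : BiFrm.{u}} (f : Hom L M) : FrameHom L.second M.second :=
  Subframe.restrict f.total L.second M.second f.map_second

/-- A biframe homomorphism is dense if its total part reflects `0`. -/
def Hom.IsDense {L M : BiFrm.{u}} (f : Hom L M) : Prop :=
  ∀ x, f.total x = ⊥ → x = ⊥

/-- A biframe homomorphism is a quotient map if its first and second parts are surjective. -/
def Hom.IsQuotient {L M : BiFrm.{u}} (f : Hom L M) : Prop :=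
  Function.Surjective f.firstMap ∧ Function.Surjective f.secondMap

/-- A closed quotient: a biframe quotient map whose total part has as its kernel the closed
congruence `∇ₐ` for some element `a` of the total part. -/
def Hom.IsClosedQuotient {L M : BiFrm.{u}} (f : Hom L M) : Prop :=
  f.IsQuotient ∧ ∃ a : L.total, FrameCongruence.ker f.total = FrameCongruence.closed a

/-- A biframe is strictly zero-dimensional if every element of the first part has a complement
(in the total part) lying in the second part, and these complements generate the second part. -/
def IsStrictlyZeroDimensional : ObjectProperty BiFrm.{u} := fun L =>
  (∀ a ∈ L.first, ∃ b ∈ L.second, IsCompl a b) ∧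
    L.second = Subframe.generate {b | ∃ a ∈ L.first, IsCompl a b}

/-- The first part functor on biframes. -/
def firstPart : BiFrm.{u} ⥤ Frm.{u} where
  obj L := Frm.of L.first
  map f := Frm.ofHom (Hom.firstMap f)
  map_id _ := rfl
  map_comp _ _ := rfl

end BiFrm

/-- The category of strictly zero-dimensional biframes and biframe homomorphisms. -/
abbrev Str0DBiFrm := BiFrm.IsStrictlyZeroDimensional.{u}.FullSubcategory

namespace Str0DBiFrm

/-- The first part functor on strictly zero-dimensional biframes. -/
def P : Str0DBiFrm.{u} ⥤ Frm.{u} :=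
  BiFrm.IsStrictlyZeroDimensional.ι ⋙ BiFrm.firstPart

end Str0DBiFrm

/-!
The frame `L₀` of a strictly zero-dimensional biframe is generated under joins by the elements
`x ⊓ yᶜ` with `x, y ∈ L₁` (`IsStrictlyZeroDimensional.le_of_basic_le`), and a homomorphism `f`
kills `x ⊓ yᶜ` exactly when `f x ≤ f y`, that is, when `f (x ⊓ y) = f x`. Hence everything that
vanishes under `f` is determined by the kernel relation `E = {(x, y) | f x = f y}` of `f` on `L₁`.
In particular `f` is dense if and only if it is injective on `L₁`
(`isDense_iff_injective_firstMap`). Moreover homomorphisms out of `L` are determined by their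
values on `L₁` (`IsStrictlyZeroDimensional.hom_ext`), so injectivity on `L₁` makes `f` monic.

The relation `E` is a subframe of `L₀ × L₀` all of whose elements have complements. Together with
these complements it generates a strictly zero-dimensional biframe (`kernelBiframe`) with two
projections to `L` that `f` identifies. It serves in both parts of the theorem.

* If `f` is monic, the two projections agree, which says that `f` is injective on `L₁`.
* If `f` is a closed quotient with kernel `∇ₐ`, then `f` is the coequalizer of the two projections:
  a homomorphism `k` that identifies them kills every `x ⊓ yᶜ ≤ a`, hence kills `a`, hence factors
  through `f`.

Finally, any `f` factors as the closed quotient by the largest element `a` with `f a = ⊥`, followed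
by a dense homomorphism. Dense homomorphisms are monic, so if `f` is an extremal epimorphism the
second factor is an isomorphism and `f` is a closed quotient.
-/

/-! ### Subframes and frame homomorphisms -/

namespace Subframe

variable {α β : Type u} [Order.Frame α] [Order.Frame β]

theorem subset_generate (s : Set α) : s ⊆ generate s :=
  fun _ hx _ hS => hS hx

theorem generate_le {s : Set α} {S : Subframe α} (h : s ⊆ S) {x : α} (hx : x ∈ generate s) :
    x ∈ S :=
  hx S h

theorem bot_mem (S : Subframe α) : (⊥ : α) ∈ S := by
  have h := S.sSup_mem' ∅ (Set.empty_subset _)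
  rwa [sSup_empty] at h

theorem sup_mem (S : Subframe α) {a b : α} (ha : a ∈ S) (hb : b ∈ S) : a ⊔ b ∈ S := by
  have h := S.sSup_mem' {a, b} (by rintro x (rfl | rfl) <;> assumption)
  rwa [sSup_pair] at h

/-- The preimage of a subframe under a frame homomorphism. -/
def comap (f : FrameHom α β) (T : Subframe β) : Subframe α where
  carrier := f ⁻¹' T
  top_mem' := by
    change f ⊤ ∈ T
    rw [map_top]; exact T.top_mem'
  inf_mem' := by
    intro a b ha hb
    change f (a ⊓ b) ∈ T
    rw [map_inf]; exact T.inf_mem' ha hb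
  sSup_mem' := by
    intro s hs
    change f (sSup s) ∈ T
    rw [map_sSup]
    exact T.sSup_mem' _ (by rintro _ ⟨x, hx, rfl⟩; exact hs hx)

/-- The image of a subframe under a frame homomorphism. -/
def map (f : FrameHom α β) (S : Subframe α) : Subframe β where
  carrier := f '' S
  top_mem' := ⟨⊤, S.top_mem', map_top f⟩
  inf_mem' := by
    rintro _ _ ⟨a, ha, rfl⟩ ⟨b, hb, rfl⟩
    exact ⟨a ⊓ b, S.inf_mem' ha hb, map_inf f a b⟩
  sSup_mem' := by
    intro s hs
    refine ⟨sSup (S ∩ f ⁻¹' s), S.sSup_mem' _ Set.inter_subset_left, ?_⟩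
    rw [map_sSup, Set.image_inter_preimage, Set.inter_eq_right.2 hs]

theorem mem_map {f : FrameHom α β} {S : Subframe α} {y : β} :
    y ∈ map f S ↔ ∃ x ∈ S, f x = y := Iff.rfl

/-- The subframe on which two frame homomorphisms agree. -/
def equalizer (f g : FrameHom α β) : Subframe α where
  carrier := {x | f x = g x}
  top_mem' := (map_top f).trans (map_top g).symm
  inf_mem' := by
    intro a b ha hb
    change f (a ⊓ b) = g (a ⊓ b)
    rw [map_inf, map_inf, show f a = g a from ha, show f b = g b from hb]
  sSup_mem' := by
    intro s hs
    change f (sSup s) = g (sSup s)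
    rw [map_sSup, map_sSup]
    exact congrArg sSup (Set.image_congr fun x hx => hs hx)

/-- The subframe of all joins of elements of a set `B` that contains `⊤` and is closed under
binary meets. -/
def ofBasis (B : Set α) (htop : ⊤ ∈ B) (hinf : ∀ x ∈ B, ∀ y ∈ B, x ⊓ y ∈ B) : Subframe α where
  carrier := {x | x ≤ sSup {b ∈ B | b ≤ x}}
  top_mem' := le_sSup ⟨htop, le_rfl⟩
  inf_mem' := by
    intro x y hx hy
    refine (inf_le_inf hx hy).trans ?_
    rw [sSup_inf_sSup]
    exact iSup₂_le fun p hp =>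
      le_sSup ⟨hinf _ hp.1.1 _ hp.2.1, inf_le_inf hp.1.2 hp.2.2⟩
  sSup_mem' := by
    intro s hs
    exact sSup_le fun x hx => (hs hx).trans
      (sSup_le_sSup fun b hb => ⟨hb.1, hb.2.trans (le_sSup hx)⟩)

theorem mem_ofBasis {B : Set α} {htop : ⊤ ∈ B} {hinf : ∀ x ∈ B, ∀ y ∈ B, x ⊓ y ∈ B} {x : α} :
    x ∈ ofBasis B htop hinf ↔ x ≤ sSup {b ∈ B | b ≤ x} := Iff.rfl

/-- The inclusion of a subframe. -/
def incl (S : Subframe α) : FrameHom S α where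
  toFun := Subtype.val
  map_inf' _ _ := rfl
  map_top' := rfl
  map_sSup' _ := rfl

theorem isCompl_coe {S : Subframe α} {a b : S} : IsCompl (a : α) b ↔ IsCompl a b := by
  refine ⟨fun h => IsCompl.of_eq (Subtype.ext ?_) (Subtype.ext ?_), fun h => h.map S.incl⟩
  · rw [coe_inf, h.inf_eq_bot]; exact (map_bot S.incl).symm
  · exact (map_sup S.incl a b).trans h.sup_eq_top

/-- Inside the subframe generated by `s`, the elements of `s` generate everything. -/
theorem mem_generate_preimage_incl {s : Set α} (x : generate s) :
    x ∈ generate ((generate s).incl ⁻¹' s) := by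
  intro S hS
  obtain ⟨y, hy, hyx⟩ := mem_map.1 <| x.2 (map (generate s).incl S)
    fun a ha => ⟨⟨a, subset_generate s ha⟩, hS ha, rfl⟩
  rwa [← show y = x from Subtype.ext hyx]

end Subframe

namespace FrameCongruence

variable {α β : Type u} [Order.Frame α] [Order.Frame β]

theorem ker_eq_closed_iff {f : FrameHom α β} {a : α} :
    ker f = closed a ↔ ∀ x y, f x = f y ↔ x ⊔ a = y ⊔ a := by
  constructor
  · intro h x y
    have h' := congrArg (fun C : FrameCongruence α => (x, y) ∈ C.carrier) h
    exact iff_of_eq h'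
  · intro h
    have hc : (ker f).carrier = (closed a).carrier := Set.ext fun p => h p.1 p.2
    have hs : (ker f).toSubframe = (closed a).toSubframe := SetLike.coe_injective hc
    cases hk : ker f
    cases hl : closed a
    rw [hk, hl] at hs
    congr

end FrameCongruence

/-- The factorization of a frame homomorphism `k` through a surjective one `q` whose kernel is
contained in that of `k`. -/
noncomputable def frameHomDesc {α β γ : Type u} [Order.Frame α] [Order.Frame β] [Order.Frame γ]
    (q : FrameHom α β) (hq : Function.Surjective q) (k : FrameHom α γ)
    (h : ∀ x y, q x = q y → k x = k y) : FrameHom β γ where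
  toFun b := k (Function.surjInv hq b)
  map_inf' a b := by
    rw [← map_inf]
    exact h _ _ (by simp only [map_inf, Function.surjInv_eq hq])
  map_top' := by
    rw [← map_top k]
    exact h _ _ (by rw [Function.surjInv_eq hq, map_top])
  map_sSup' s := by
    rw [← Set.image_image k, ← map_sSup]
    refine h _ _ ?_
    simp only [map_sSup, Set.image_image, Function.surjInv_eq hq, Set.image_id']

theorem frameHomDesc_apply {α β γ : Type u} [Order.Frame α] [Order.Frame β] [Order.Frame γ]
    (q : FrameHom α β) (hq : Function.Surjective q) (k : FrameHom α γ)
    (h : ∀ x y, q x = q y → k x = k y) (x : α) : frameHomDesc q hq k h (q x) = k x :=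
  h _ _ (Function.surjInv_eq hq (q x))

/-- The nucleus `x ↦ x ⊔ a` of the closed congruence `∇ₐ`. -/
def closedNucleus {α : Type u} [Order.Frame α] (a : α) : Nucleus α where
  toFun x := x ⊔ a
  map_inf' x y := sup_inf_right x y a
  idempotent' x := by simp
  le_apply' x := le_sup_left

namespace BiFrm

variable {L M N Q : BiFrm.{u}}

/-! ### Biframe quotients -/

theorem Hom.isQuotient_iff {q : Hom L Q} : q.IsQuotient ↔
    (∀ y ∈ Q.first, ∃ x ∈ L.first, q.total x = y) ∧
      ∀ y ∈ Q.second, ∃ x ∈ L.second, q.total x = y := by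
  constructor
  · refine fun h => ⟨fun y hy => ?_, fun y hy => ?_⟩
    · obtain ⟨x, hx⟩ := h.1 ⟨y, hy⟩
      exact ⟨x, x.2, congrArg Subtype.val hx⟩
    · obtain ⟨x, hx⟩ := h.2 ⟨y, hy⟩
      exact ⟨x, x.2, congrArg Subtype.val hx⟩
  · rintro ⟨h₁, h₂⟩
    refine ⟨fun y => ?_, fun y => ?_⟩
    · obtain ⟨x, hx, h⟩ := h₁ y y.2
      exact ⟨⟨x, hx⟩, Subtype.ext h⟩
    · obtain ⟨x, hx, h⟩ := h₂ y y.2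
      exact ⟨⟨x, hx⟩, Subtype.ext h⟩

theorem Hom.IsQuotient.surjective {q : Hom L Q} (hq : q.IsQuotient) :
    Function.Surjective q.total := by
  intro y
  obtain ⟨h₁, h₂⟩ := Hom.isQuotient_iff.1 hq
  let I := Subframe.map q.total (Subframe.generate Set.univ)
  have hI : ∀ {x}, q.total x ∈ I := ⟨_, Subframe.subset_generate _ (Set.mem_univ _), rfl⟩
  obtain ⟨x, -, hx⟩ := Subframe.mem_map.1 <| Subframe.generate_le (S := I) (by
    rintro z (hz | hz)
    · obtain ⟨x, -, rfl⟩ := h₁ z hz; exact hI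
    · obtain ⟨x, -, rfl⟩ := h₂ z hz; exact hI) (Q.generates y)
  exact ⟨x, hx⟩

/-- The factorization of a biframe homomorphism `k` through a quotient map `q` whose kernel is
contained in that of `k`. -/
noncomputable def Hom.desc (q : Hom L Q) (hq : q.IsQuotient) (k : Hom L N)
    (h : ∀ x y, q.total x = q.total y → k.total x = k.total y) : Hom Q N where
  total := frameHomDesc q.total hq.surjective k.total h
  map_first y hy := by
    obtain ⟨x, hx, rfl⟩ := (Hom.isQuotient_iff.1 hq).1 y hy
    rw [frameHomDesc_apply]; exact k.map_first x hx
  map_second y hy := by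
    obtain ⟨x, hx, rfl⟩ := (Hom.isQuotient_iff.1 hq).2 y hy
    rw [frameHomDesc_apply]; exact k.map_second x hx

theorem Hom.desc_apply (q : Hom L Q) (hq : q.IsQuotient) (k : Hom L N)
    (h : ∀ x y, q.total x = q.total y → k.total x = k.total y) (x : L.total) :
    (q.desc hq k h).total (q.total x) = k.total x :=
  frameHomDesc_apply _ _ _ h x

/-- The biframe `L / ∇ₐ`. Its total part consists of the elements above `a`, as fixed points of
`x ↦ x ⊔ a`, and its two parts are the images of those of `L`. -/
def closedQuotient (L : BiFrm.{u}) (a : L.total) : BiFrm.{u} where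
  total := Set.range (closedNucleus a)
  first := L.first.map (closedNucleus a).restrict
  second := L.second.map (closedNucleus a).restrict
  generates := by
    intro y S hS
    obtain ⟨x, rfl⟩ := (closedNucleus a).giRestrict.l_surjective y
    refine Subframe.generate_le (S := S.comap (closedNucleus a).restrict) ?_ (L.generates x)
    rintro z (hz | hz)
    · exact hS (Or.inl ⟨z, hz, rfl⟩)
    · exact hS (Or.inr ⟨z, hz, rfl⟩)

/-- The quotient map `L → L / ∇ₐ`. -/
def closedQuotientMap (L : BiFrm.{u}) (a : L.total) : Hom L (L.closedQuotient a) where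
  total := (closedNucleus a).restrict
  map_first x hx := ⟨x, hx, rfl⟩
  map_second x hx := ⟨x, hx, rfl⟩

theorem closedQuotientMap_isQuotient (L : BiFrm.{u}) (a : L.total) :
    (L.closedQuotientMap a).IsQuotient :=
  Hom.isQuotient_iff.2 ⟨fun _ hy => hy, fun _ hy => hy⟩

theorem closedQuotientMap_eq_iff {L : BiFrm.{u}} {a x y : L.total} :
    (L.closedQuotientMap a).total x = (L.closedQuotientMap a).total y ↔ x ⊔ a = y ⊔ a :=
  Subtype.ext_iff

/-! ### Strictly zero-dimensional biframes -/

namespace IsStrictlyZeroDimensional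

/-- The elements `x ⊓ d` with `x` in the first part and `d` the complement of an element of the
first part form a basis of the total part. -/
theorem le_of_basic_le (hL : L.IsStrictlyZeroDimensional) {w z : L.total}
    (h : ∀ x ∈ L.first, ∀ y ∈ L.first, ∀ d, IsCompl y d → x ⊓ d ≤ w → x ⊓ d ≤ z) : w ≤ z := by
  let B : Set L.total := {b | ∃ x ∈ L.first, ∃ y ∈ L.first, ∃ d, IsCompl y d ∧ x ⊓ d = b}
  have htop : ⊤ ∈ B := ⟨⊤, L.first.top_mem', ⊥, L.first.bot_mem, ⊤, isCompl_bot_top, inf_idem ⊤⟩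
  have hinf : ∀ x ∈ B, ∀ y ∈ B, x ⊓ y ∈ B := by
    rintro _ ⟨x, hx, y, hy, d, hd, rfl⟩ _ ⟨x', hx', y', hy', d', hd', rfl⟩
    exact ⟨x ⊓ x', L.first.inf_mem' hx hx', y ⊔ y', L.first.sup_mem hy hy', d ⊓ d',
      hd.sup_inf hd', inf_inf_inf_comm x x' d d'⟩
  have hB : ∀ b ∈ B, b ∈ Subframe.ofBasis B htop hinf := fun b hb => le_sSup ⟨hb, le_rfl⟩
  have hw : w ∈ Subframe.ofBasis B htop hinf := by
    refine Subframe.generate_le ?_ (L.generates w)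
    rintro x (hx | hx)
    · exact hB x ⟨x, hx, ⊥, L.first.bot_mem, ⊤, isCompl_bot_top, inf_top_eq x⟩
    · rw [hL.2] at hx
      refine Subframe.generate_le ?_ hx
      rintro d ⟨y, hy, hd⟩
      exact hB d ⟨⊤, L.first.top_mem', y, hy, d, hd, top_inf_eq d⟩
  refine (Subframe.mem_ofBasis.1 hw).trans (sSup_le ?_)
  rintro _ ⟨⟨x, hx, y, hy, d, hd, rfl⟩, hle⟩
  exact h x hx y hy d hd hle

/-- A homomorphism preserves complements, so it is determined by its values on the first part. -/
theorem hom_ext (hL : L.IsStrictlyZeroDimensional) {f g : Hom L N}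
    (h : ∀ x ∈ L.first, f.total x = g.total x) : f = g := by
  refine Hom.ext (FrameHom.ext fun w =>
    Subframe.generate_le (S := Subframe.equalizer f.total g.total) ?_ (L.generates w))
  rintro x (hx | hx)
  · exact h x hx
  · rw [hL.2] at hx
    refine Subframe.generate_le ?_ hx
    rintro d ⟨y, hy, hd⟩
    have hf := hd.map f.total
    rw [h y hy] at hf
    exact hf.right_unique (hd.map g.total)

theorem of_isQuotient (hL : L.IsStrictlyZeroDimensional) {q : Hom L Q} (hq : q.IsQuotient) :
    Q.IsStrictlyZeroDimensional := by
  obtain ⟨h₁, h₂⟩ := Hom.isQuotient_iff.1 hq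
  have hc : ∀ y ∈ Q.first, ∃ e ∈ Q.second, IsCompl y e := by
    intro y hy
    obtain ⟨x, hx, rfl⟩ := h₁ y hy
    obtain ⟨d, hd, hxd⟩ := hL.1 x hx
    exact ⟨q.total d, q.map_second d hd, hxd.map q.total⟩
  refine ⟨hc, SetLike.ext fun e => ⟨fun he => ?_, fun he => Subframe.generate_le ?_ he⟩⟩
  · obtain ⟨d, hd, rfl⟩ := h₂ e he
    rw [hL.2] at hd
    refine Subframe.generate_le (S := Subframe.comap q.total
      (Subframe.generate {b | ∃ a ∈ Q.first, IsCompl a b})) ?_ hd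
    rintro d ⟨x, hx, hxd⟩
    exact Subframe.subset_generate _ ⟨q.total x, q.map_first x hx, hxd.map q.total⟩
  · rintro e ⟨y, hy, hye⟩
    obtain ⟨e', he', hye'⟩ := hc y hy
    rwa [hye.right_unique hye']

end IsStrictlyZeroDimensional

section Complemented

variable {α : Type u} [Order.Frame α] (E : Subframe α)

/-- A subframe `E` together with all complements of its elements. -/
def withCompls : Set α := {x | x ∈ E ∨ ∃ a ∈ E, IsCompl a x}

/-- The biframe with first part `E` and second part generated by the complements of elements
of `E`. -/
def ofSubframe : BiFrm.{u} where
  total := Subframe.generate (withCompls E)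
  first := E.comap (Subframe.generate (withCompls E)).incl
  second := Subframe.generate
    {b | ∃ a ∈ E.comap (Subframe.generate (withCompls E)).incl, IsCompl a b}
  generates x := by
    refine Subframe.generate_le ?_ (Subframe.mem_generate_preimage_incl x)
    rintro ⟨y, hy⟩ (hE | ⟨a, ha, hay⟩)
    · exact Subframe.subset_generate _ (Or.inl hE)
    · refine Subframe.subset_generate _ (Or.inr (Subframe.subset_generate _ ?_))
      exact ⟨⟨a, Subframe.subset_generate _ (Or.inl ha)⟩, ha, Subframe.isCompl_coe.1 hay⟩

theorem ofSubframe_isStrictlyZeroDimensional (hE : ∀ a ∈ E, ∃ b, IsCompl a b) :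
    (ofSubframe E).IsStrictlyZeroDimensional := by
  refine ⟨fun a ha => ?_, rfl⟩
  obtain ⟨b, hb⟩ := hE a.1 ha
  have hab : IsCompl a (⟨b, Subframe.subset_generate _ (Or.inr ⟨a.1, ha, hb⟩)⟩ :
      Subframe.generate (withCompls E)) := Subframe.isCompl_coe.1 hb
  exact ⟨_, Subframe.subset_generate _ ⟨a, ha, hab⟩, hab⟩

/-- A frame homomorphism into the total part of a strictly zero-dimensional biframe which maps `E`
into the first part is a biframe homomorphism on `ofSubframe E`. -/
def ofSubframeHom (hL : L.IsStrictlyZeroDimensional) (g : FrameHom α L.total)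
    (hg : ∀ a ∈ E, g a ∈ L.first) : Hom (ofSubframe E) L where
  total := g.comp (Subframe.generate (withCompls E)).incl
  map_first a ha := hg a.1 ha
  map_second b hb := by
    refine Subframe.generate_le (S := Subframe.comap (g.comp (Subframe.incl _)) L.second) ?_ hb
    rintro d ⟨a, ha, had⟩
    rw [hL.2]
    exact Subframe.subset_generate _ ⟨g a.1, hg a.1 ha, had.map (g.comp (Subframe.incl _))⟩

end Complemented

/-! ### The kernel relation on the first part -/

/-- The relation `{(x, y) | f x = f y}` on the first part, as a subframe of `L₀ × L₀`. -/
def kernelFirst (f : Hom L M) : Subframe (L.total × L.total) where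
  carrier := {p | p.1 ∈ L.first ∧ p.2 ∈ L.first ∧ f.total p.1 = f.total p.2}
  top_mem' := ⟨L.first.top_mem', L.first.top_mem', rfl⟩
  inf_mem' hp hq := ⟨L.first.inf_mem' hp.1 hq.1, L.first.inf_mem' hp.2.1 hq.2.1,
    (FrameCongruence.ker f.total).inf_mem' hp.2.2 hq.2.2⟩
  sSup_mem' s hs := by
    refine ⟨L.first.sSup_mem' _ ?_, L.first.sSup_mem' _ ?_,
      (FrameCongruence.ker f.total).sSup_mem' s fun p hp => (hs hp).2.2⟩
    · rintro _ ⟨p, hp, rfl⟩; exact (hs hp).1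
    · rintro _ ⟨p, hp, rfl⟩; exact (hs hp).2.1

/-- The biframe with first part `{(x, y) | f x = f y}`. -/
def kernelBiframe (f : Hom L M) : BiFrm.{u} := ofSubframe (kernelFirst f)

theorem kernelBiframe_isStrictlyZeroDimensional (hL : L.IsStrictlyZeroDimensional) (f : Hom L M) :
    (kernelBiframe f).IsStrictlyZeroDimensional := by
  refine ofSubframe_isStrictlyZeroDimensional _ fun p hp => ?_
  obtain ⟨b, -, hb⟩ := hL.1 p.1 hp.1
  obtain ⟨c, -, hc⟩ := hL.1 p.2 hp.2.1
  exact ⟨(b, c), IsCompl.of_eq (Prod.ext hb.inf_eq_bot hc.inf_eq_bot)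
    (Prod.ext hb.sup_eq_top hc.sup_eq_top)⟩

/-- The first projection `kernelBiframe f → L`. -/
def kernelFst (hL : L.IsStrictlyZeroDimensional) (f : Hom L M) : Hom (kernelBiframe f) L :=
  ofSubframeHom _ hL
    { toFun := Prod.fst, map_inf' := fun _ _ => rfl, map_top' := rfl, map_sSup' := fun _ => rfl }
    fun _ hp => hp.1

/-- The second projection `kernelBiframe f → L`. -/
def kernelSnd (hL : L.IsStrictlyZeroDimensional) (f : Hom L M) : Hom (kernelBiframe f) L :=
  ofSubframeHom _ hL
    { toFun := Prod.snd, map_inf' := fun _ _ => rfl, map_top' := rfl, map_sSup' := fun _ => rfl }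
    fun _ hp => hp.2.1

theorem kernel_condition (hL : L.IsStrictlyZeroDimensional) (f : L ⟶ M) :
    (show kernelBiframe f ⟶ L from kernelFst hL f) ≫ f =
      (show kernelBiframe f ⟶ L from kernelSnd hL f) ≫ f :=
  (kernelBiframe_isStrictlyZeroDimensional hL f).hom_ext fun _ hp => hp.2.2

/-- A homomorphism that identifies the two projections identifies all elements of the first part
that are identified by `f`. -/
theorem eq_of_kernel_comp_eq (hL : L.IsStrictlyZeroDimensional) (f : L ⟶ M) {k : L ⟶ N}
    (h : (show kernelBiframe f ⟶ L from kernelFst hL f) ≫ k =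
      (show kernelBiframe f ⟶ L from kernelSnd hL f) ≫ k)
    {x y : L.total} (hx : x ∈ L.first) (hy : y ∈ L.first)
    (hxy : Hom.total f x = Hom.total f y) : Hom.total k x = Hom.total k y :=
  congrArg (fun g : Hom (kernelBiframe f) N => g.total
    ⟨(x, y), Subframe.subset_generate _ (Or.inl ⟨hx, hy, hxy⟩)⟩) h

/-! ### Density and injectivity on the first part -/

/-- If `k` identifies those elements of the first part that `f` identifies, then `k` kills
everything that `f` kills. -/
theorem Hom.eq_bot_of_eq_bot (hL : L.IsStrictlyZeroDimensional) {f : Hom L M} {k : Hom L N}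
    (h : ∀ x ∈ L.first, ∀ y ∈ L.first, f.total x = f.total y → k.total x = k.total y)
    {a : L.total} (ha : f.total a = ⊥) : k.total a = ⊥ := by
  -- The largest element killed by `k`.
  let c := sSup {x | k.total x = ⊥}
  have hc : k.total c = ⊥ := by
    rw [map_sSup, sSup_eq_bot]
    rintro _ ⟨x, hx, rfl⟩
    exact hx
  refine le_bot_iff.1 ((OrderHomClass.mono k.total (hL.le_of_basic_le ?_ : a ≤ c)).trans_eq hc)
  intro x hx y hy d hd hle
  have hf : f.total x ⊓ f.total d = ⊥ := by
    rw [← map_inf]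
    exact le_bot_iff.1 ((OrderHomClass.mono f.total hle).trans_eq ha)
  have hfxy : f.total x ≤ f.total y :=
    (hd.map f.total).symm.disjoint_left_iff.1 (disjoint_iff.2 hf)
  have hk := h (x ⊓ y) (L.first.inf_mem' hx hy) x hx (by rw [map_inf, inf_eq_left.2 hfxy])
  rw [map_inf, inf_eq_left] at hk
  refine le_sSup (show k.total (x ⊓ d) = ⊥ from ?_)
  rw [map_inf]
  exact ((hd.map k.total).disjoint.mono_left hk).eq_bot

theorem Hom.isDense_iff_injective_firstMap (hL : L.IsStrictlyZeroDimensional) {f : Hom L M} :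
    f.IsDense ↔ Function.Injective f.firstMap := by
  constructor
  · intro hf
    have key : ∀ x ∈ L.first, ∀ y ∈ L.first, f.total x = f.total y → x ≤ y := by
      intro x _ y hy hxy
      obtain ⟨d, -, hd⟩ := hL.1 y hy
      refine hd.symm.disjoint_left_iff.1 (disjoint_iff.2 (hf _ ?_))
      rw [map_inf, hxy]
      exact (hd.map f.total).inf_eq_bot
    intro x y hxy
    have hxy' : f.total x = f.total y := congrArg Subtype.val hxy
    exact Subtype.ext ((key x x.2 y y.2 hxy').antisymm (key y y.2 x x.2 hxy'.symm))
  · intro hf a ha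
    exact Hom.eq_bot_of_eq_bot hL (k := ⟨FrameHom.id _, fun _ h => h, fun _ h => h⟩)
      (fun x hx y hy hxy =>
        congrArg Subtype.val (@hf ⟨x, hx⟩ ⟨y, hy⟩ (Subtype.ext hxy))) ha

end BiFrm

/-! ### Monomorphisms and epimorphisms -/

namespace Str0DBiFrm

open BiFrm

variable {L M : Str0DBiFrm.{u}}

theorem mono_of_injective {f : L ⟶ M} (hf : Function.Injective (Hom.firstMap f.hom)) : Mono f := by
  refine ⟨fun {K} g h hgh => ObjectProperty.hom_ext _ (K.property.hom_ext fun x hx => ?_)⟩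
  have h' : g.hom ≫ f.hom = h.hom ≫ f.hom := congrArg (·.hom) hgh
  have hx' := congrArg (fun k : Hom K.obj M.obj => k.total x) h'
  exact congrArg Subtype.val (@hf ⟨_, Hom.map_first g.hom x hx⟩ ⟨_, Hom.map_first h.hom x hx⟩
    (Subtype.ext hx'))

/-- `kernelBiframe` as an object of the category of strictly zero-dimensional biframes. -/
def kernel (f : L ⟶ M) : Str0DBiFrm.{u} :=
  ⟨kernelBiframe f.hom, kernelBiframe_isStrictlyZeroDimensional L.property f.hom⟩

/-- The first projection of `kernel f`. -/
def kernelLeft (f : L ⟶ M) : kernel f ⟶ L :=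
  ObjectProperty.homMk (kernelFst L.property f.hom)

/-- The second projection of `kernel f`. -/
def kernelRight (f : L ⟶ M) : kernel f ⟶ L :=
  ObjectProperty.homMk (kernelSnd L.property f.hom)

theorem kernel_w (f : L ⟶ M) : kernelLeft f ≫ f = kernelRight f ≫ f :=
  ObjectProperty.hom_ext _ (kernel_condition L.property f.hom)

theorem injective_of_mono (f : L ⟶ M) [Mono f] : Function.Injective (Hom.firstMap f.hom) := by
  have h : kernelLeft f ≫ 𝟙 L = kernelRight f ≫ 𝟙 L := by
    rw [Category.comp_id, Category.comp_id, ← cancel_mono f, kernel_w f]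
  intro x y hxy
  exact Subtype.ext (eq_of_kernel_comp_eq L.property f.hom (k := 𝟙 L.obj) (congrArg (·.hom) h)
    x.2 y.2 (congrArg Subtype.val hxy))

/-- A closed quotient is the coequalizer of the projections of its `kernel`. -/
theorem isRegularEpi_of_isClosedQuotient {f : L ⟶ M} (hf : Hom.IsClosedQuotient f.hom) :
    IsRegularEpi f := by
  obtain ⟨hq, a, ha⟩ := hf
  rw [FrameCongruence.ker_eq_closed_iff] at ha
  have key : ∀ {N : Str0DBiFrm.{u}} (k : L ⟶ N), kernelLeft f ≫ k = kernelRight f ≫ k →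
      ∀ x y, Hom.total f.hom x = Hom.total f.hom y → Hom.total k.hom x = Hom.total k.hom y := by
    intro N k hk x y hxy
    have hka : Hom.total k.hom a = ⊥ :=
      Hom.eq_bot_of_eq_bot L.property (f := f.hom) (k := k.hom)
        (fun x hx y hy => eq_of_kernel_comp_eq L.property f.hom (congrArg (·.hom) hk) hx hy)
        (((ha a ⊥).2 (by simp)).trans (map_bot _))
    have h := congrArg (Hom.total k.hom) ((ha x y).1 hxy)
    simpa only [map_sup, hka, sup_bot_eq] using h
  refine ⟨⟨⟨kernel f, kernelLeft f, kernelRight f, kernel_w f,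
    Limits.Cofork.IsColimit.mk _
      (fun s => ObjectProperty.homMk (Hom.desc f.hom hq s.π.hom (key s.π s.condition)))
      (fun s => ?_) (fun s m hm => ?_)⟩⟩⟩
  · exact ObjectProperty.hom_ext _ (Hom.ext (FrameHom.ext fun x =>
      Hom.desc_apply f.hom hq s.π.hom (key s.π s.condition) x))
  · refine ObjectProperty.hom_ext _ (Hom.ext (FrameHom.ext fun y => ?_))
    obtain ⟨x, rfl⟩ := hq.surjective y
    have h : f.hom ≫ m.hom = s.π.hom := congrArg (·.hom) hm
    exact (congrArg (fun k : Hom L.obj s.pt.obj => k.total x) h).trans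
      (Hom.desc_apply f.hom hq s.π.hom (key s.π s.condition) x).symm

/-- The factorization of `f` through the closed quotient by the largest element killed by `f` has a
dense, hence monic, second factor. -/
theorem isClosedQuotient_of_extremalEpi (f : L ⟶ M) [ExtremalEpi f] :
    Hom.IsClosedQuotient f.hom := by
  let a := sSup {x | Hom.total f.hom x = ⊥}
  have ha : Hom.total f.hom a = ⊥ := by
    rw [map_sSup, sSup_eq_bot]
    rintro _ ⟨x, hx, rfl⟩
    exact hx
  have hq := closedQuotientMap_isQuotient L.obj a
  have hker : ∀ x y, (closedQuotientMap L.obj a).total x = (closedQuotientMap L.obj a).total y →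
      Hom.total f.hom x = Hom.total f.hom y := by
    intro x y hxy
    have h := congrArg (Hom.total f.hom) (closedQuotientMap_eq_iff.1 hxy)
    simpa only [map_sup, ha, sup_bot_eq] using h
  let Q : Str0DBiFrm.{u} := ⟨closedQuotient L.obj a, L.property.of_isQuotient hq⟩
  let p : L ⟶ Q := ObjectProperty.homMk (closedQuotientMap L.obj a)
  let i : Q ⟶ M := ObjectProperty.homMk (Hom.desc _ hq f.hom hker)
  have hi : ∀ x, Hom.total i.hom (Hom.total p.hom x) = Hom.total f.hom x :=
    Hom.desc_apply _ hq f.hom hker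
  have fac : p ≫ i = f := ObjectProperty.hom_ext _ (Hom.ext (FrameHom.ext hi))
  have hdense : Hom.IsDense i.hom := by
    intro y hy
    obtain ⟨x, rfl⟩ := hq.surjective y
    have hx : x ≤ a := le_sSup ((hi x).symm.trans hy)
    refine Eq.trans ?_ (map_bot (closedQuotientMap L.obj a).total)
    exact closedQuotientMap_eq_iff.2 (by rw [sup_eq_right.2 hx, bot_sup_eq])
  have : Mono i := mono_of_injective ((Hom.isDense_iff_injective_firstMap Q.property).1 hdense)
  have : IsIso i := ExtremalEpi.isIso f p i fac
  let j : M ⟶ Q := inv i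
  have hij : ∀ y, Hom.total i.hom (Hom.total j.hom y) = y := by
    have h : j.hom ≫ i.hom = 𝟙 M.obj := congrArg (·.hom) (IsIso.inv_hom_id i)
    exact fun y => congrArg (fun k : Hom M.obj M.obj => k.total y) h
  have hji : ∀ y, Hom.total j.hom (Hom.total i.hom y) = y := by
    have h : i.hom ≫ j.hom = 𝟙 Q.obj := congrArg (·.hom) (IsIso.hom_inv_id i)
    exact fun y => congrArg (fun k : Hom Q.obj Q.obj => k.total y) h
  refine ⟨Hom.isQuotient_iff.2 ⟨fun y hy => ?_, fun y hy => ?_⟩, a,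
    FrameCongruence.ker_eq_closed_iff.2 fun x y => ⟨fun hxy => ?_, fun hxy => ?_⟩⟩
  · obtain ⟨x, hx, hxy⟩ := (Hom.isQuotient_iff.1 hq).1 _ (Hom.map_first j.hom y hy)
    exact ⟨x, hx, (hi x).symm.trans ((congrArg _ hxy).trans (hij y))⟩
  · obtain ⟨x, hx, hxy⟩ := (Hom.isQuotient_iff.1 hq).2 _ (Hom.map_second j.hom y hy)
    exact ⟨x, hx, (hi x).symm.trans ((congrArg _ hxy).trans (hij y))⟩
  · rw [← hi, ← hi] at hxy
    have h := congrArg (Hom.total j.hom) hxy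
    rw [hji, hji] at h
    exact closedQuotientMap_eq_iff.1 h
  · exact hker x y (closedQuotientMap_eq_iff.2 hxy)

end Str0DBiFrm

theorem mainTheorem7 {L M : Str0DBiFrm.{u}} (f : L ⟶ M) :
    ((ExtremalEpi f ↔ IsRegularEpi f) ∧ (IsRegularEpi f ↔ BiFrm.Hom.IsClosedQuotient f.hom)) ∧
    ((Mono f ↔ BiFrm.Hom.IsDense f.hom) ∧
      (BiFrm.Hom.IsDense f.hom ↔ Function.Injective (Str0DBiFrm.P.map f))) := by
  have hreg : IsRegularEpi f → ExtremalEpi f := fun _ => inferInstance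
  have hext : ExtremalEpi f → BiFrm.Hom.IsClosedQuotient f.hom :=
    fun _ => Str0DBiFrm.isClosedQuotient_of_extremalEpi f
  have hclosed : BiFrm.Hom.IsClosedQuotient f.hom → IsRegularEpi f :=
    Str0DBiFrm.isRegularEpi_of_isClosedQuotient
  have hdense : BiFrm.Hom.IsDense f.hom ↔ Function.Injective (BiFrm.Hom.firstMap f.hom) :=
    BiFrm.Hom.isDense_iff_injective_firstMap L.property
  exact ⟨⟨⟨hclosed ∘ hext, hreg⟩, ⟨hext ∘ hreg, hclosed⟩⟩,
    ⟨⟨fun _ => hdense.2 (Str0DBiFrm.injective_of_mono f),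
      fun h => Str0DBiFrm.mono_of_injective (hdense.1 h)⟩, hdense⟩⟩
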